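/- Let $\alpha\in(0,1)$ and let $g$ be a probability density on $\mathbb{R}$ that is unimodal, symmetric about $0$ and logconcave (i.e. $\log g$ is concave on the support of $g$), with cdf $G$ and inverse cdf $G^{-1}$. Let $X\sim g(x-\theta)$ with unknown $\theta\ge 0$. For each $x$ with $G(x)>0$ let $[l(x),u(x)]\subseteq[0,\infty)$ be the highest posterior density (HPD) credible interval for $\theta$ given $X=x$ of credibility $1-\alpha$ under the flat prior $\pi^*(\theta)=1_{[0,\infty)}(\theta)$: its posterior probability is $1-\alpha$, and the posterior density $\theta\mapsto g(x-\theta)1_{[0,\infty)}(\theta)/G(x)$ at each of its points is at least as large as at each $\theta'\ge 0$ outside it (where the posterior density takes equal values, points closer to $x$ are included first, so that the interval is uniquely determined). Let $$C(\theta)=P_\theta\big(l(X)\le\theta\le u(X)\big),\qquad \theta\ge 0,$$ be its frequentist coverage, and let $d_0=G^{-1}\!\left(\frac{1}{1+\alpha}\right)$ and $d_1=G^{-1}\!\left(1-\frac{\alpha}{2}\right)$. Then $C$ is strictly decreasing on the interval $(d_1,2d_0)$. -/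

import Mathlib

open MeasureTheory Set

noncomputable section

/-- `g` is a probability density on `ℝ` which is symmetric about `0`, unimodal (with mode `0`) and
logconcave, i.e. `log g` is a concave function on the (convex) set where `g` is positive. -/
structure IsSymmUnimodalLogconcaveDensity (g : ℝ → ℝ) : Prop where
  nonneg : ∀ z, 0 ≤ g z
  integrable : Integrable g
  integral_eq_one : ∫ z, g z = 1
  symm : ∀ z, g (-z) = g z
  monotoneOn : MonotoneOn g (Iic 0)
  antitoneOn : AntitoneOn g (Ici 0)
  logconcave : ConcaveOn ℝ (Function.support g) (fun z => Real.log (g z))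

/-- The cdf `G` of the density `g`. -/
def densityCdf (g : ℝ → ℝ) (z : ℝ) : ℝ := ∫ t in Iic z, g t

/-- The inverse cdf (quantile function) `G⁻¹`. -/
def densityQuantile (g : ℝ → ℝ) (p : ℝ) : ℝ := sInf {z | p ≤ densityCdf g z}

/-- `d₀ = G⁻¹(1 / (1 + α))`. -/
def dZero (g : ℝ → ℝ) (α : ℝ) : ℝ := densityQuantile g (1 / (1 + α))

/-- `d₁ = G⁻¹(1 - α / 2)`. -/
def dOne (g : ℝ → ℝ) (α : ℝ) : ℝ := densityQuantile g (1 - α / 2)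

/-- The law `P_θ` of the observation `X`, with density `x ↦ g (x - θ)`. -/
def sampleLaw (g : ℝ → ℝ) (θ : ℝ) : Measure ℝ :=
  volume.withDensity (fun x => ENNReal.ofReal (g (x - θ)))

/-- The flat prior truncated to the parameter space: `π*(θ) = 1` for `θ ≥ 0`, and `0` otherwise. -/
def flatPrior : ℝ → ℝ := (Ici (0 : ℝ)).indicator (fun _ => 1)

/-- The marginal density of the observation at `x` under the prior `π*`. -/
def marginalDensity (g : ℝ → ℝ) (x : ℝ) : ℝ := ∫ θ, g (x - θ) * flatPrior θ

/-- The posterior density of `θ` given `X = x` under `π*`; it is meaningful whenever the marginal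
density at `x` is positive. -/
def posteriorDensity (g : ℝ → ℝ) (x θ : ℝ) : ℝ :=
  g (x - θ) * flatPrior θ / marginalDensity g x

/-- `[l, u]` is the highest posterior density (HPD) credible interval of credibility `1 - α` given
`X = x`: a subinterval of the parameter space with posterior probability `1 - α`, in which the
posterior density is at least as large as at every parameter value left out. Where the posterior
density is flat, values closer to the observation `x` come first; for densities `g` with flat parts
(such as the uniform ones) an HPD interval would not be determined without this convention. -/
structure IsHPDCredibleInterval (g : ℝ → ℝ) (α x l u : ℝ) : Prop where
  nonneg : 0 ≤ l
  le : l ≤ u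
  credibility : ∫ θ in Icc l u, posteriorDensity g x θ = 1 - α
  highest : ∀ θ ∈ Icc l u, ∀ θ' ∈ Ici (0 : ℝ) \ Icc l u,
    posteriorDensity g x θ' ≤ posteriorDensity g x θ
  tie : ∀ θ ∈ Icc l u, ∀ θ' ∈ Ici (0 : ℝ) \ Icc l u,
    posteriorDensity g x θ' = posteriorDensity g x θ → |θ - x| ≤ |θ' - x|

/-- The frequentist coverage `C(θ) = P_θ(θ ∈ [l(X), u(X)])`. -/
def coverage (g l u : ℝ → ℝ) (θ : ℝ) : ℝ := (sampleLaw g θ).real {x | θ ∈ Icc (l x) (u x)}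

/-- The HPD credible interval exists at every `x` with positive marginal density. -/
theorem exists_isHPDCredibleInterval (g : ℝ → ℝ) (hg : IsSymmUnimodalLogconcaveDensity g)
    (α : ℝ) (hα : α ∈ Ioo (0 : ℝ) 1) (x : ℝ) (hx : 0 < marginalDensity g x) :
    ∃ l u : ℝ, IsHPDCredibleInterval g α x l u := by
  have hkey : ∀ z w : ℝ, |z| ≤ |w| → g w ≤ g z := by
    intro z w h
    have habs : ∀ t : ℝ, g |t| = g t := by
      intro t
      rcases abs_choice t with h | h <;> rw [h]
      exact hg.symm t
    rw [← habs z, ← habs w]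
    exact hg.antitoneOn (abs_nonneg z) (abs_nonneg w) h
  have hprior : ∀ θ, 0 ≤ θ → flatPrior θ = 1 := fun θ h => by
    simp [flatPrior, h]
  have hfun : (fun θ => g (x - θ) * flatPrior θ) = (Ici (0 : ℝ)).indicator (fun θ => g (x - θ)) := by
    funext θ
    by_cases h : 0 ≤ θ <;> simp [flatPrior, h]
  have hint : Integrable (posteriorDensity g x) := by
    have h1 : Integrable (fun θ => g (x - θ)) := hg.integrable.comp_sub_left x
    have h2 : Integrable (fun θ => g (x - θ) * flatPrior θ) := by
      rw [hfun]; exact h1.indicator measurableSet_Ici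
    exact h2.div_const _
  have htot : ∫ θ in Ioi (0 : ℝ), posteriorDensity g x θ = 1 := by
    rw [← integral_Ici_eq_integral_Ioi]
    have hm : marginalDensity g x = ∫ θ in Ici (0 : ℝ), g (x - θ) * flatPrior θ := by
      unfold marginalDensity
      rw [hfun, setIntegral_indicator measurableSet_Ici, inter_self,
        integral_indicator measurableSet_Ici]
    unfold posteriorDensity
    rw [integral_div, ← hm, div_self hx.ne']
  let H : ℝ → ℝ := fun y => ∫ θ in (0 : ℝ)..y, posteriorDensity g x θ
  have hH : Continuous H :=
    intervalIntegral.continuous_primitive (fun a b => hint.intervalIntegrable) 0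
  let F : ℝ → ℝ := fun r => H (x + r) - H (max 0 (x - r))
  have hF : Continuous F := by fun_prop
  have hlim : Filter.Tendsto H Filter.atTop (nhds 1) := by
    have := intervalIntegral_tendsto_integral_Ioi (f := posteriorDensity g x) (μ := volume) 0
      hint.integrableOn Filter.tendsto_id
    rw [htot] at this
    exact this
  have hev : ∀ᶠ y in Filter.atTop, 1 - α < H y :=
    hlim.eventually (lt_mem_nhds (by linarith [hα.1]))
  obtain ⟨N, hN⟩ := Filter.eventually_atTop.1 hev
  let r₀ : ℝ := max 0 (-x)
  let r₁ : ℝ := |x| + |N|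
  have hr : r₀ ≤ r₁ := by
    simp only [r₀, r₁]
    exact max_le (by positivity) (by linarith [neg_le_abs x, abs_nonneg N])
  have hF0 : F r₀ = 0 := by
    simp only [F, r₀]
    rcases le_total 0 x with h | h
    · rw [max_eq_left (by linarith : -x ≤ 0)]; simp [h]
    · rw [max_eq_right (by linarith : 0 ≤ -x)]
      rw [max_eq_left (by linarith : x - -x ≤ 0)]; simp
  have hF1 : 1 - α < F r₁ := by
    simp only [F, r₁]
    rw [max_eq_left (by linarith [le_abs_self x, abs_nonneg N])]
    have h0 : H 0 = 0 := by simp [H]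
    rw [h0, sub_zero]
    exact hN _ (by linarith [neg_le_abs x, le_abs_self N])
  obtain ⟨r, ⟨hr0, hr1⟩, hFr⟩ := intermediate_value_Icc hr hF.continuousOn
    (show 1 - α ∈ Icc (F r₀) (F r₁) from ⟨by rw [hF0]; linarith [hα.2], hF1.le⟩)
  have hrn : 0 ≤ r := (le_max_left _ _).trans hr0
  have hrx : 0 ≤ x + r := by
    have := (le_max_right 0 (-x)).trans hr0
    linarith
  have hlu : max 0 (x - r) ≤ x + r := max_le hrx (by linarith)
  have hin : ∀ θ ∈ Icc (max 0 (x - r)) (x + r), |θ - x| ≤ r := by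
    intro θ hθ
    have := (le_max_right 0 (x - r)).trans hθ.1
    exact abs_le.2 ⟨by linarith, by linarith [hθ.2]⟩
  have hout : ∀ θ ∈ Ici (0 : ℝ) \ Icc (max 0 (x - r)) (x + r), r < |θ - x| := by
    intro θ hθ
    by_contra! h
    have := abs_le.1 h
    exact hθ.2 ⟨max_le hθ.1 (by linarith), by linarith⟩
  refine ⟨max 0 (x - r), x + r, le_max_left _ _, hlu, ?_, ?_, ?_⟩
  · rw [integral_Icc_eq_integral_Ioc, ← intervalIntegral.integral_of_le hlu, ← hFr]
    exact (intervalIntegral.integral_interval_sub_left hint.intervalIntegrable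
      hint.intervalIntegrable).symm
  · intro θ hθ θ' hθ'
    unfold posteriorDensity
    rw [hprior θ ((le_max_left _ _).trans hθ.1), hprior θ' hθ'.1, mul_one, mul_one]
    refine div_le_div_of_nonneg_right (hkey _ _ ?_) hx.le
    rw [abs_sub_comm x, abs_sub_comm x]
    exact (hin θ hθ).trans (hout θ' hθ').le
  · intro θ hθ θ' hθ' _
    exact (hin θ hθ).trans (hout θ' hθ').le

end

/-! For `θ` in the range, the observations whose interval contains `θ` form, up to a null set, `[a,
r + θ]`, where `0 < a ≤ θ/2`, `G(a - θ) = α G(a)` and `2 G(r) - 1 = (1 - α) G(r + θ)`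
(`coverage_eq`): the lower equation describes an interval truncated at `0`, the upper one an
interval centred at `x`. Hence `C(θ) = G(r) - α G(a)`, and the point is that between `θ₁ < θ₂` the
term `G(r)` gains less than `α G(a)`.

Since `g` need not be differentiable, increments of `G` are bounded by lengths times endpoint values
of `g`. The two equations are linked by `Δθ = Δ(r + θ) - Δr = Δa + Δ(θ - a)`, and
`increment_lt_of_bounds` compares them once `κ = g(2d)/g(d)`, `d = d₀`, satisfies `κ (1 - α) < 2α`.
That inequality is logconcavity integrated over `[0, d]`, combined with `G(d) = 1/(1 + α)`
(`apply_two_mul_lt`). -/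

lemma densityCdf_sub_eq (g : ℝ → ℝ) (x θ : ℝ) :
    densityCdf g (x - θ) = ∫ t in Iic x, g (t - θ) := by
  have := (measurePreserving_sub_right volume θ).setIntegral_preimage_emb
    (measurableEmbedding_subRight θ) g (Iic (x - θ))
  rw [densityCdf, ← this]
  simp

namespace IsSymmUnimodalLogconcaveDensity

variable {g : ℝ → ℝ}

/-! ### Logconcavity, the cdf, and the sign of `G(x - θ) - c G(x)`. -/

/-- The inner points are convex combinations of the outer ones with swapped weights, so adding the
two concavity inequalities for `log g` cancels the weights. This is the only form in which
logconcavity is used. -/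
lemma mul_le_mul_of_add_eq (hg : IsSymmUnimodalLogconcaveDensity g) {x y z w : ℝ}
    (hxy : x ≤ y) (hyw : y ≤ w) (h : x + w = y + z) : g x * g w ≤ g y * g z := by
  rcases (hg.nonneg x).eq_or_lt with hx | hx
  · rw [← hx, zero_mul]; exact mul_nonneg (hg.nonneg _) (hg.nonneg _)
  rcases (hg.nonneg w).eq_or_lt with hw | hw
  · rw [← hw, mul_zero]; exact mul_nonneg (hg.nonneg _) (hg.nonneg _)
  rcases (hxy.trans hyw).eq_or_lt with hxw | hxw
  · have h1 : y = x := le_antisymm (by linarith) hxy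
    have h2 : z = w := by linarith
    rw [h1, h2]
  obtain ⟨t, ht⟩ : ∃ t, t = (w - y) / (w - x) := ⟨_, rfl⟩
  have hd : 0 < w - x := by linarith
  have ht0 : 0 ≤ t := by rw [ht]; exact div_nonneg (by linarith) hd.le
  have ht1 : 0 ≤ 1 - t := by
    rw [ht, sub_nonneg, div_le_one hd]; linarith
  have htm : t * (w - x) = w - y := by rw [ht]; field_simp
  have hy : y = t • x + (1 - t) • w := by simp only [smul_eq_mul]; linarith
  have hz : z = (1 - t) • x + t • w := by simp only [smul_eq_mul]; linarith
  have hxs : x ∈ Function.support g := hx.ne'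
  have hws : w ∈ Function.support g := hw.ne'
  have cy := hg.logconcave.2 hxs hws ht0 ht1 (by ring)
  have cz := hg.logconcave.2 hxs hws ht1 ht0 (by ring)
  have hys := hg.logconcave.1 hxs hws ht0 ht1 (by ring)
  have hzs := hg.logconcave.1 hxs hws ht1 ht0 (by ring)
  rw [← hy] at cy hys
  rw [← hz] at cz hzs
  simp only [smul_eq_mul] at cy cz
  have hy0 : 0 < g y := lt_of_le_of_ne (hg.nonneg y) (Ne.symm hys)
  have hz0 : 0 < g z := lt_of_le_of_ne (hg.nonneg z) (Ne.symm hzs)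
  rw [← Real.log_le_log_iff (mul_pos hx hw) (mul_pos hy0 hz0), Real.log_mul hx.ne' hw.ne',
    Real.log_mul hy0.ne' hz0.ne']
  linarith

lemma apply_le_of_abs_le (hg : IsSymmUnimodalLogconcaveDensity g) {z w : ℝ} (h : |z| ≤ |w|) :
    g w ≤ g z := by
  have habs : ∀ t : ℝ, g |t| = g t := fun t => by
    rcases abs_choice t with h | h <;> rw [h]
    exact hg.symm t
  rw [← habs z, ← habs w]
  exact hg.antitoneOn (abs_nonneg z) (abs_nonneg w) h

lemma cdf_sub (hg : IsSymmUnimodalLogconcaveDensity g) (x y : ℝ) :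
    densityCdf g y - densityCdf g x = ∫ t in x..y, g t :=
  intervalIntegral.integral_Iic_sub_Iic hg.integrable.integrableOn hg.integrable.integrableOn

lemma cdf_mono (hg : IsSymmUnimodalLogconcaveDensity g) : Monotone (densityCdf g) := fun x y h => by
  rw [← sub_nonneg, hg.cdf_sub]
  exact intervalIntegral.integral_nonneg h fun t _ => hg.nonneg t

lemma cdf_continuous (hg : IsSymmUnimodalLogconcaveDensity g) : Continuous (densityCdf g) := by
  have h : densityCdf g = fun y => densityCdf g 0 + ∫ t in (0 : ℝ)..y, g t := by
    funext y; rw [← hg.cdf_sub]; ring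
  rw [h]
  exact continuous_const.add
    (intervalIntegral.continuous_primitive (fun a b => hg.integrable.intervalIntegrable) 0)

lemma one_sub_cdf (hg : IsSymmUnimodalLogconcaveDensity g) (x : ℝ) :
    1 - densityCdf g x = ∫ t in Ioi x, g t := by
  rw [← hg.integral_eq_one, ← intervalIntegral.integral_Iic_add_Ioi
    (b := x) hg.integrable.integrableOn hg.integrable.integrableOn, densityCdf]
  ring

lemma cdf_neg (hg : IsSymmUnimodalLogconcaveDensity g) (x : ℝ) :
    densityCdf g (-x) = 1 - densityCdf g x := by
  rw [hg.one_sub_cdf, densityCdf]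
  have := integral_comp_neg_Iic (-x) g
  simpa only [hg.symm, neg_neg] using this

lemma cdf_zero (hg : IsSymmUnimodalLogconcaveDensity g) : densityCdf g 0 = 1 / 2 := by
  have := hg.cdf_neg 0
  rw [neg_zero] at this
  linarith

lemma cdf_le_one (hg : IsSymmUnimodalLogconcaveDensity g) (x : ℝ) : densityCdf g x ≤ 1 := by
  rw [← sub_nonneg, hg.one_sub_cdf]
  exact integral_nonneg hg.nonneg

lemma cdf_tendsto (hg : IsSymmUnimodalLogconcaveDensity g) :
    Filter.Tendsto (densityCdf g) Filter.atTop (nhds 1) := by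
  rw [← hg.integral_eq_one]
  exact (aecover_Iic Filter.tendsto_id).integral_tendsto_of_countably_generated hg.integrable

lemma cdf_sub_le (hg : IsSymmUnimodalLogconcaveDensity g) {x y : ℝ} (hx : 0 ≤ x) (hxy : x ≤ y) :
    densityCdf g y - densityCdf g x ≤ g x * (y - x) := by
  rw [hg.cdf_sub]
  have := intervalIntegral.integral_mono_on hxy hg.integrable.intervalIntegrable
    (intervalIntegrable_const (c := g x))
    (fun t ht => hg.antitoneOn hx (hx.trans ht.1) ht.1)
  simpa [mul_comm] using this

lemma le_cdf_sub (hg : IsSymmUnimodalLogconcaveDensity g) {x y : ℝ} (hx : 0 ≤ x) (hxy : x ≤ y) :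
    g y * (y - x) ≤ densityCdf g y - densityCdf g x := by
  rw [hg.cdf_sub]
  have := intervalIntegral.integral_mono_on hxy
    (intervalIntegrable_const (c := g y)) hg.integrable.intervalIntegrable
    (fun t ht => hg.antitoneOn (hx.trans ht.1) (hx.trans hxy) ht.2)
  simpa [mul_comm] using this

lemma cdf_lt (hg : IsSymmUnimodalLogconcaveDensity g) {x y : ℝ} (hx : 0 ≤ x) (hxy : x < y)
    (h1 : densityCdf g x < 1) : densityCdf g x < densityCdf g y := by
  rcases (hg.nonneg y).eq_or_lt with h | h
  · have h2 : 1 - densityCdf g y = 0 := by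
      rw [hg.one_sub_cdf]
      refine (setIntegral_congr_fun measurableSet_Ioi (g := fun _ => (0 : ℝ)) ?_).trans (by simp)
      intro t ht
      exact le_antisymm (h ▸ hg.antitoneOn (hx.trans hxy.le)
        ((hx.trans hxy.le).trans (le_of_lt ht)) (le_of_lt ht)) (hg.nonneg t)
    linarith
  · have := hg.le_cdf_sub hx hxy.le
    have := mul_pos h (sub_pos.2 hxy)
    linarith

/-- By logconcavity `t ↦ g(t - θ)/g(t)` is nondecreasing. If the cdf ratio were at least `c` at `x ≤
0`, the density ratio would be at least `c` on all of `[x, 0]`, and the cdf ratio would still be at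
least `c` at `0`. -/
lemma cdf_lt_of_mul_lt (hg : IsSymmUnimodalLogconcaveDensity g) {c θ x : ℝ} (hθ : 0 ≤ θ)
    (h0 : densityCdf g (-θ) < c * densityCdf g 0) (hx : x ≤ 0) (hGx : 0 < densityCdf g x) :
    densityCdf g (x - θ) < c * densityCdf g x := by
  by_contra! hc
  have hgx : 0 < g x := by
    by_contra! h
    refine hGx.ne' ((setIntegral_congr_fun measurableSet_Iic (g := fun _ => (0 : ℝ)) ?_).trans
      (by simp))
    intro t ht
    exact le_antisymm ((hg.monotoneOn (le_trans ht hx) hx ht).trans h) (hg.nonneg t)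
  have hshift : densityCdf g (x - θ) = ∫ t in Iic x, g (t - θ) :=
    densityCdf_sub_eq g x θ
  have hsub : Integrable fun t => g (t - θ) := hg.integrable.comp_sub_right θ
  have h1 : densityCdf g (x - θ) ≤ g (x - θ) / g x * densityCdf g x := by
    rw [hshift, densityCdf, ← integral_const_mul]
    refine setIntegral_mono_on hsub.integrableOn
      (hg.integrable.const_mul _).integrableOn measurableSet_Iic fun t ht => ?_
    rw [div_mul_eq_mul_div, le_div_iff₀ hgx]
    have ht' : t ≤ x := ht
    exact hg.mul_le_mul_of_add_eq (by linarith) (by linarith) (by ring)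
  have h2 : g (x - θ) / g x * (densityCdf g 0 - densityCdf g x)
      ≤ densityCdf g (-θ) - densityCdf g (x - θ) := by
    have e : densityCdf g (-θ) - densityCdf g (x - θ) = ∫ t in x..0, g (t - θ) := by
      rw [hg.cdf_sub, intervalIntegral.integral_comp_sub_right (fun t => g t), zero_sub]
    rw [e, hg.cdf_sub, ← intervalIntegral.integral_const_mul]
    refine intervalIntegral.integral_mono_on hx (hg.integrable.const_mul _).intervalIntegrable
      hsub.intervalIntegrable fun t ht => ?_
    rw [div_mul_eq_mul_div, div_le_iff₀ hgx]
    have ht' : x ≤ t := ht.1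
    have := hg.mul_le_mul_of_add_eq (x := x - θ) (y := x) (z := t - θ) (w := t) (by linarith)
      ht' (by ring)
    linarith
  have h3 : c ≤ g (x - θ) / g x := le_of_mul_le_mul_right (hc.trans h1) hGx
  have h4 := mul_le_mul_of_nonneg_right h3 (sub_nonneg.2 (hg.cdf_mono hx))
  linarith

/-- On `[0, θ]` the integrand `g(t - θ) - c g(t)` is nondecreasing, so `G(x - θ) - c G(x)` is convex
there; being negative at `0`, it increases strictly once it is nonnegative. -/
lemma cdf_mul_lt_of_le (hg : IsSymmUnimodalLogconcaveDensity g) {c θ x y : ℝ} (hc : 0 ≤ c)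
    (h0 : densityCdf g (-θ) < c * densityCdf g 0) (hx : 0 ≤ x)
    (hxθ : c * densityCdf g x ≤ densityCdf g (x - θ)) (hxy : x < y) (hy : y ≤ θ) :
    c * densityCdf g y < densityCdf g (y - θ) := by
  have hsub : Integrable fun t => g (t - θ) := hg.integrable.comp_sub_right θ
  have hcg : Integrable fun t => c * g t := hg.integrable.const_mul c
  have hd : ∀ a b, ∫ t in a..b, (g (t - θ) - c * g t) =
      densityCdf g (b - θ) - densityCdf g (a - θ) - c * (densityCdf g b - densityCdf g a) := by
    intro a b
    rw [intervalIntegral.integral_sub hsub.intervalIntegrable hcg.intervalIntegrable,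
      intervalIntegral.integral_const_mul, intervalIntegral.integral_comp_sub_right (fun t => g t),
      hg.cdf_sub, hg.cdf_sub]
  obtain ⟨z, hz, hzpos⟩ : ∃ z ∈ Icc 0 x, 0 < g (z - θ) - c * g z := by
    by_contra! h
    have h1 := intervalIntegral.integral_mono_on hx (hsub.sub hcg).intervalIntegrable
      (intervalIntegrable_const (c := (0 : ℝ))) h
    have h2 := hd 0 x
    simp only [Pi.sub_apply, intervalIntegral.integral_zero, zero_sub] at h1 h2
    linarith
  have h1 := intervalIntegral.integral_mono_on hxy.le
    (intervalIntegrable_const (c := g (z - θ) - c * g z)) (hsub.sub hcg).intervalIntegrable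
    (fun t ht => by
      have hzt : z ≤ t := hz.2.trans ht.1
      have htθ : t ≤ θ := ht.2.trans hy
      have h3 : g (z - θ) ≤ g (t - θ) :=
        hg.monotoneOn (mem_Iic.2 (by linarith)) (mem_Iic.2 (by linarith)) (by linarith)
      have h4 := mul_le_mul_of_nonneg_left (hg.antitoneOn hz.1 (hz.1.trans hzt) hzt) hc
      simp only [Pi.sub_apply]
      linarith)
  simp only [Pi.sub_apply, intervalIntegral.integral_const, smul_eq_mul] at h1
  rw [hd] at h1
  have := mul_pos (sub_pos.2 hxy) hzpos
  linarith

/-! ### Quantiles above the median. -/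

lemma bddBelow_quantile (hg : IsSymmUnimodalLogconcaveDensity g) {p : ℝ} (hp : 1 / 2 < p) :
    BddBelow {z | p ≤ densityCdf g z} :=
  ⟨0, fun z (hz : p ≤ densityCdf g z) => by
    by_contra! h
    have := hg.cdf_mono h.le
    rw [hg.cdf_zero] at this
    linarith⟩

lemma quantile_le (hg : IsSymmUnimodalLogconcaveDensity g) {p z : ℝ} (hp : 1 / 2 < p)
    (hz : p ≤ densityCdf g z) : densityQuantile g p ≤ z :=
  csInf_le (hg.bddBelow_quantile hp) hz

lemma cdf_lt_of_lt_quantile (hg : IsSymmUnimodalLogconcaveDensity g) {p z : ℝ} (hp : 1 / 2 < p)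
    (hz : z < densityQuantile g p) : densityCdf g z < p := by
  by_contra! h
  exact (hg.quantile_le hp h).not_gt hz

lemma cdf_quantile (hg : IsSymmUnimodalLogconcaveDensity g) {p : ℝ} (hp : 1 / 2 < p) (hp1 : p < 1) :
    densityCdf g (densityQuantile g p) = p := by
  have hne : {z | p ≤ densityCdf g z}.Nonempty :=
    (hg.cdf_tendsto.eventually (lt_mem_nhds hp1)).exists.imp fun _ h => h.le
  have hcl : IsClosed {z | p ≤ densityCdf g z} := isClosed_le continuous_const hg.cdf_continuous
  refine le_antisymm ?_ (hcl.csInf_mem hne (hg.bddBelow_quantile hp))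
  refine ContinuousWithinAt.closure_le (f := densityCdf g) (g := fun _ => p)
    (s := Iio (densityQuantile g p)) (x := densityQuantile g p) ?_
    hg.cdf_continuous.continuousWithinAt continuousWithinAt_const
    (fun y hy => (hg.cdf_lt_of_lt_quantile hp hy).le)
  rw [closure_Iio]
  exact mem_Iic.2 le_rfl

lemma quantile_pos (hg : IsSymmUnimodalLogconcaveDensity g) {p : ℝ} (hp : 1 / 2 < p) (hp1 : p < 1) :
    0 < densityQuantile g p := by
  by_contra! h
  have := hg.cdf_mono h
  rw [hg.cdf_quantile hp hp1, hg.cdf_zero] at this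
  linarith

/-! ### HPD intervals: membership expressed through the cdf. -/

lemma marginalDensity_eq (g : ℝ → ℝ) (x : ℝ) : marginalDensity g x = densityCdf g x := by
  have hfun : (fun θ => g (x - θ) * flatPrior θ) = (Ici (0 : ℝ)).indicator (fun θ => g (x - θ)) := by
    funext θ
    by_cases h : 0 ≤ θ <;> simp [flatPrior, h]
  rw [marginalDensity, hfun, integral_indicator measurableSet_Ici, densityCdf,
    integral_Ici_eq_integral_Ioi]
  have := integral_comp_neg_Iic (0 : ℝ) fun t => g (x - t)
  rw [neg_zero] at this
  rw [← this]
  have h2 := densityCdf_sub_eq g 0 (-x)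
  rw [zero_sub, neg_neg, densityCdf] at h2
  rw [h2]
  simp only [sub_neg_eq_add, add_comm]

lemma posteriorDensity_eq (g : ℝ → ℝ) (x : ℝ) {θ : ℝ} (hθ : 0 ≤ θ) :
    posteriorDensity g x θ = g (x - θ) / densityCdf g x := by
  rw [posteriorDensity, marginalDensity_eq, flatPrior, indicator_of_mem (mem_Ici.2 hθ), mul_one]

lemma cdf_credibility (hg : IsSymmUnimodalLogconcaveDensity g) {α x l u : ℝ}
    (hx : 0 < densityCdf g x) (h : IsHPDCredibleInterval g α x l u) :
    densityCdf g (x - l) - densityCdf g (x - u) = (1 - α) * densityCdf g x := by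
  rw [← h.credibility, setIntegral_congr_fun measurableSet_Icc
    (fun θ hθ => posteriorDensity_eq g x (h.nonneg.trans hθ.1)), integral_div,
    div_mul_cancel₀ _ hx.ne', integral_Icc_eq_integral_Ioc, ← intervalIntegral.integral_of_le h.le,
    intervalIntegral.integral_comp_sub_left (fun t => g t), hg.cdf_sub]

lemma abs_sub_le_abs_sub (hg : IsSymmUnimodalLogconcaveDensity g) {α x l u : ℝ}
    (hx : 0 < densityCdf g x) (h : IsHPDCredibleInterval g α x l u) {θ θ' : ℝ} (hθ : θ ∈ Icc l u)
    (h0 : 0 ≤ θ') (hθ' : θ' ∉ Icc l u) : |θ - x| ≤ |θ' - x| := by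
  rcases (h.highest θ hθ θ' ⟨h0, hθ'⟩).eq_or_lt with he | hlt
  · exact h.tie θ hθ θ' ⟨h0, hθ'⟩ he
  · by_contra! hc
    rw [posteriorDensity_eq g x h0, posteriorDensity_eq g x (h.nonneg.trans hθ.1),
      div_lt_div_iff_of_pos_right hx] at hlt
    refine hlt.not_ge (hg.apply_le_of_abs_le ?_)
    rw [abs_sub_comm x, abs_sub_comm x]
    exact hc.le

section Membership

variable {α x l u θ : ℝ}

lemma cdf_le_of_mem_of_lt (hg : IsSymmUnimodalLogconcaveDensity g) (hx : 0 < densityCdf g x)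
    (h : IsHPDCredibleInterval g α x l u) (hθ0 : 0 ≤ θ) (hθ : θ ∈ Icc l u) (hlt : θ < x) :
    2 * densityCdf g (x - θ) - 1 ≤ (1 - α) * densityCdf g x := by
  -- The interval reaches the reflection of `θ` in `x`: otherwise some excluded point would be
  -- strictly closer to `x` than `θ`.
  have hu : 2 * x - θ ≤ u := by
    by_contra! hc
    have hm : max u θ < 2 * x - θ := max_lt hc (by linarith)
    obtain ⟨t, ht1, ht2⟩ := exists_between hm
    have htu := (le_max_left u θ).trans_lt ht1
    have htθ := (le_max_right u θ).trans_lt ht1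
    have := hg.abs_sub_le_abs_sub hx h hθ (hθ0.trans htθ.le) (fun hh => hh.2.not_gt htu)
    rw [abs_sub_comm, abs_of_pos (sub_pos.2 hlt)] at this
    exact this.not_gt (abs_lt.2 ⟨by linarith, by linarith⟩)
  have h1 := hg.cdf_mono (show x - θ ≤ x - l by linarith [hθ.1])
  have h2 := hg.cdf_mono (show x - u ≤ -(x - θ) by linarith)
  rw [hg.cdf_neg] at h2
  linarith [hg.cdf_credibility hx h]

lemma cdf_le_of_mem_of_gt (hg : IsSymmUnimodalLogconcaveDensity g) (hx : 0 < densityCdf g x)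
    (h : IsHPDCredibleInterval g α x l u) (hθ0 : 0 < θ) (hθ : θ ∈ Icc l u) (hlt : 2 * x ≤ θ) :
    α * densityCdf g x ≤ densityCdf g (x - θ) := by
  have hl : l ≤ 0 := by
    by_contra! hc
    obtain ⟨t, ht1, ht2⟩ := exists_between (lt_min hc hθ0)
    have htl := ht2.trans_le (min_le_left _ _)
    have htθ := ht2.trans_le (min_le_right _ _)
    have := hg.abs_sub_le_abs_sub hx h hθ ht1.le (fun hh => hh.1.not_gt htl)
    rw [abs_of_pos (show 0 < θ - x by linarith)] at this
    exact this.not_gt (abs_lt.2 ⟨by linarith, by linarith⟩)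
  have h1 := hg.cdf_mono (show x ≤ x - l by linarith)
  have h2 := hg.cdf_mono (show x - u ≤ x - θ by linarith [hθ.2])
  linarith [hg.cdf_credibility hx h]

lemma le_cdf_of_notMem_of_lt (hg : IsSymmUnimodalLogconcaveDensity g) (hx : 0 < densityCdf g x)
    (h : IsHPDCredibleInterval g α x l u) (hθ0 : 0 ≤ θ) (hθ : θ ∉ Icc l u) (hlt : θ ≤ x) :
    (1 - α) * densityCdf g x ≤ 2 * densityCdf g (x - θ) - 1 := by
  have hl := hg.abs_sub_le_abs_sub hx h (left_mem_Icc.2 h.le) hθ0 hθ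
  have hu := hg.abs_sub_le_abs_sub hx h (right_mem_Icc.2 h.le) hθ0 hθ
  rw [abs_sub_comm θ, abs_of_nonneg (sub_nonneg.2 hlt)] at hl hu
  have h1 := hg.cdf_mono (show x - l ≤ x - θ by linarith [(abs_le.1 hl).1])
  have h2 := hg.cdf_mono (show -(x - θ) ≤ x - u by linarith [(abs_le.1 hu).2])
  rw [hg.cdf_neg] at h2
  linarith [hg.cdf_credibility hx h]

/-- The whole interval lies within distance `θ - x` of `x` and in `[0, ∞)`; the minimum records
which constraint binds on the left. -/
lemma le_cdf_of_notMem_of_gt (hg : IsSymmUnimodalLogconcaveDensity g) (hx : 0 < densityCdf g x)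
    (h : IsHPDCredibleInterval g α x l u) (hθ0 : 0 ≤ θ) (hθ : θ ∉ Icc l u) (hlt : x ≤ θ) :
    (1 - α) * densityCdf g x ≤ densityCdf g (min x (θ - x)) - densityCdf g (x - θ) := by
  have hl := hg.abs_sub_le_abs_sub hx h (left_mem_Icc.2 h.le) hθ0 hθ
  have hu := hg.abs_sub_le_abs_sub hx h (right_mem_Icc.2 h.le) hθ0 hθ
  rw [abs_of_nonneg (sub_nonneg.2 hlt)] at hl hu
  have h1 := hg.cdf_mono (show x - l ≤ min x (θ - x) from
    le_min (by linarith [h.nonneg]) (by linarith [(abs_le.1 hl).1]))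
  have h2 := hg.cdf_mono (show x - θ ≤ x - u by linarith [(abs_le.1 hu).2])
  linarith [hg.cdf_credibility hx h]

end Membership

/-! ### The acceptance region and the coverage formula. -/

lemma sampleLaw_Icc (hg : IsSymmUnimodalLogconcaveDensity g) (θ : ℝ) {a b : ℝ} (hab : a ≤ b) :
    (sampleLaw g θ).real (Icc a b) = densityCdf g (b - θ) - densityCdf g (a - θ) := by
  have hi : Integrable fun t => g (t - θ) := hg.integrable.comp_sub_right θ
  rw [sampleLaw, measureReal_def, withDensity_apply _ measurableSet_Icc,
    ← ofReal_integral_eq_lintegral_ofReal hi.integrableOn (ae_of_all _ fun t => hg.nonneg _),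
    ENNReal.toReal_ofReal (integral_nonneg fun t => hg.nonneg _), integral_Icc_eq_integral_Ioc,
    ← intervalIntegral.integral_of_le hab,
    intervalIntegral.integral_comp_sub_right (fun t => g t), hg.cdf_sub]

lemma cdf_pos_of_apply_sub_pos (hg : IsSymmUnimodalLogconcaveDensity g) {x θ : ℝ} (hθ : 0 < θ)
    (h : 0 < g (x - θ)) : 0 < densityCdf g x := by
  rcases le_or_gt 0 x with hx | hx
  · have := hg.cdf_mono hx
    rw [hg.cdf_zero] at this
    linarith
  · have hx' := hg.le_cdf_sub (x := -x) (y := θ - x) (by linarith) (by linarith)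
    have e : g (θ - x) = g (x - θ) := by rw [← hg.symm, neg_sub]
    rw [e] at hx'
    have h1 := hg.cdf_neg (-x)
    rw [neg_neg] at h1
    have h2 := mul_pos h hθ
    have h3 := hg.cdf_le_one (θ - x)
    have h4 : θ - x - -x = θ := by ring
    rw [h4] at hx'
    linarith

variable {α θ : ℝ}

lemma exists_lower_crossing (hg : IsSymmUnimodalLogconcaveDensity g) (hθ0 : 0 < θ)
    (hθ1 : 1 - α / 2 < densityCdf g θ) (hθ2 : densityCdf g (θ / 2) < 1 / (1 + α))
    (hα : α ∈ Ioo (0 : ℝ) 1) :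
    ∃ a, 0 < a ∧ a ≤ θ / 2 ∧ densityCdf g (a - θ) = α * densityCdf g a := by
  have hc : Continuous fun x => densityCdf g (x - θ) - α * densityCdf g x := by
    have := hg.cdf_continuous
    fun_prop
  have h0 : densityCdf g (0 - θ) - α * densityCdf g 0 < 0 := by
    rw [zero_sub, hg.cdf_neg, hg.cdf_zero]; linarith
  have h1 : 0 ≤ densityCdf g (θ / 2 - θ) - α * densityCdf g (θ / 2) := by
    rw [show θ / 2 - θ = -(θ / 2) by ring, hg.cdf_neg]
    rw [lt_div_iff₀ (by linarith [hα.1])] at hθ2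
    linarith
  obtain ⟨a, ha, hfa⟩ := intermediate_value_Icc (by linarith : (0 : ℝ) ≤ θ / 2) hc.continuousOn
    ⟨h0.le, h1⟩
  simp only at hfa
  refine ⟨a, lt_of_le_of_ne ha.1 ?_, ha.2, by linarith⟩
  rintro rfl
  linarith

lemma exists_upper_crossing (hg : IsSymmUnimodalLogconcaveDensity g) (hθ0 : 0 < θ)
    (hθ1 : 1 - α / 2 < densityCdf g θ) (hα : α ∈ Ioo (0 : ℝ) 1) :
    ∃ r, 0 < r ∧ 2 * densityCdf g r - 1 = (1 - α) * densityCdf g (r + θ) := by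
  have hc : Continuous fun r => 2 * densityCdf g r - 1 - (1 - α) * densityCdf g (r + θ) := by
    have := hg.cdf_continuous
    fun_prop
  have h0 : 2 * densityCdf g 0 - 1 - (1 - α) * densityCdf g (0 + θ) < 0 := by
    rw [hg.cdf_zero]
    have : 0 < (1 - α) * densityCdf g (0 + θ) := by
      rw [zero_add]; exact mul_pos (by linarith [hα.2]) (by linarith [hα.2])
    linarith
  have h1 : 0 ≤ 2 * densityCdf g θ - 1 - (1 - α) * densityCdf g (θ + θ) := by
    have := mul_le_mul_of_nonneg_left (hg.cdf_le_one (θ + θ)) (by linarith [hα.2] : 0 ≤ 1 - α)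
    linarith
  obtain ⟨r, hr, hfr⟩ := intermediate_value_Icc hθ0.le hc.continuousOn ⟨h0.le, h1⟩
  simp only at hfr
  refine ⟨r, lt_of_le_of_ne hr.1 ?_, by linarith⟩
  rintro rfl
  linarith

lemma cdf_le_of_crossing (hg : IsSymmUnimodalLogconcaveDensity g) (hα : α ∈ Ioo (0 : ℝ) 1)
    {r : ℝ} (hr : 2 * densityCdf g r - 1 = (1 - α) * densityCdf g (r + θ)) :
    densityCdf g r ≤ 1 - α / 2 := by
  have := mul_le_mul_of_nonneg_left (hg.cdf_le_one (r + θ)) (by linarith [hα.2] : 0 ≤ 1 - α)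
  linarith

lemma two_mul_cdf_sub_strictMono (hg : IsSymmUnimodalLogconcaveDensity g) (hα : α ∈ Ioo (0 : ℝ) 1)
    (hθ0 : 0 ≤ θ) {v w : ℝ} (hv : 0 ≤ v) (hvw : v < w) (h1 : densityCdf g v < 1) :
    2 * densityCdf g v - 1 - (1 - α) * densityCdf g (v + θ)
      < 2 * densityCdf g w - 1 - (1 - α) * densityCdf g (w + θ) := by
  have h2 := hg.cdf_lt hv hvw h1
  have h3 : densityCdf g (w + θ) - densityCdf g (v + θ) ≤ densityCdf g w - densityCdf g v := by
    rw [hg.cdf_sub, hg.cdf_sub, ← intervalIntegral.integral_comp_add_right (fun t => g t)]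
    exact intervalIntegral.integral_mono_on hvw.le
      (hg.integrable.comp_add_right θ).intervalIntegrable hg.integrable.intervalIntegrable
      fun t ht => hg.antitoneOn (hv.trans ht.1)
        (add_nonneg (hv.trans ht.1) hθ0) (le_add_of_nonneg_right hθ0)
  have h4 := mul_le_mul_of_nonneg_left h3 (by linarith [hα.2] : 0 ≤ 1 - α)
  have h5 := mul_pos hα.1 (sub_pos.2 h2)
  linarith

theorem coverage_eq (hg : IsSymmUnimodalLogconcaveDensity g) (hα : α ∈ Ioo (0 : ℝ) 1)
    {l u : ℝ → ℝ}
    (hI : ∀ x : ℝ, 0 < marginalDensity g x → IsHPDCredibleInterval g α x (l x) (u x))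
    (hθ0 : 0 < θ) (hθ1 : 1 - α / 2 < densityCdf g θ) (hθ2 : densityCdf g (θ / 2) < 1 / (1 + α))
    {a r : ℝ} (ha0 : 0 < a) (haθ : a ≤ θ / 2) (ha : densityCdf g (a - θ) = α * densityCdf g a)
    (hr0 : 0 < r) (hr : 2 * densityCdf g r - 1 = (1 - α) * densityCdf g (r + θ)) :
    coverage g l u θ = densityCdf g r - densityCdf g (a - θ) := by
  have hrc := hg.cdf_le_of_crossing hα hr
  have hr1 : densityCdf g r < 1 := by linarith [hα.1]
  have hneg : densityCdf g (-θ) < α * densityCdf g 0 := by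
    rw [hg.cdf_neg, hg.cdf_zero]; linarith
  have hae : {x | θ ∈ Icc (l x) (u x)} =ᵐ[sampleLaw g θ] Icc a (r + θ) := by
    have hm : AEMeasurable (fun x => ENNReal.ofReal (g (x - θ))) volume :=
      (hg.integrable.comp_sub_right θ).aestronglyMeasurable.aemeasurable.ennreal_ofReal
    refine Filter.eventuallyEq_set.2 ((ae_withDensity_iff' hm).2 ?_)
    -- The membership criteria are non-strict, so the two boundary observations are discarded as a
    -- null set.
    filter_upwards [Measure.ae_ne volume a, Measure.ae_ne volume (r + θ)] with x hxa hxr hgx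
    have hx : 0 < densityCdf g x := hg.cdf_pos_of_apply_sub_pos hθ0
      (ENNReal.ofReal_pos.1 (pos_iff_ne_zero.2 hgx))
    have hH := hI x (by rwa [marginalDensity_eq])
    constructor
    · intro hmem
      refine ⟨?_, ?_⟩
      · by_contra! hxa'
        have h1 := hg.cdf_le_of_mem_of_gt hx hH hθ0 hmem (by linarith)
        rcases le_or_gt x 0 with hx0 | hx0
        · exact h1.not_gt (hg.cdf_lt_of_mul_lt hθ0.le hneg hx0 hx)
        · have := hg.cdf_mul_lt_of_le hα.1.le hneg hx0.le h1 hxa' (by linarith)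
          linarith
      · by_contra! hxr'
        have h1 := hg.cdf_le_of_mem_of_lt hx hH hθ0.le hmem (by linarith)
        have h2 := hg.two_mul_cdf_sub_strictMono (w := x - θ) hα hθ0.le hr0.le (by linarith) hr1
        rw [sub_add_cancel] at h2
        linarith
    · intro hmem
      by_contra hnot
      have hax : a < x := lt_of_le_of_ne hmem.1 (Ne.symm hxa)
      rcases le_or_gt x θ with hxθ | hxθ
      · have h1 := hg.le_cdf_of_notMem_of_gt hx hH hθ0.le hnot hxθ
        rcases le_or_gt x (θ / 2) with h2 | h2
        · rw [min_eq_left (by linarith)] at h1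
          have := hg.cdf_mul_lt_of_le hα.1.le hneg ha0.le ha.ge hax hxθ
          linarith
        -- Here `θ < 2 d₀` enters: exclusion would force `(1 + α) G(θ/2) ≥ 1`.
        · rw [min_eq_right (by linarith)] at h1
          have h3 := hg.cdf_neg (θ - x)
          rw [neg_sub] at h3
          have h4 := hg.cdf_mono (show θ - x ≤ θ / 2 by linarith)
          have h5 := hg.cdf_mono h2.le
          have h6 := mul_le_mul_of_nonneg_left h5 (by linarith [hα.2] : 0 ≤ 1 - α)
          rw [lt_div_iff₀ (by linarith [hα.1])] at hθ2
          linarith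
      · have h1 := hg.le_cdf_of_notMem_of_lt hx hH hθ0.le hnot hxθ.le
        have hxr' : x < r + θ := lt_of_le_of_ne hmem.2 hxr
        have h3 := hg.cdf_mono (show x - θ ≤ r by linarith)
        have h2 := hg.two_mul_cdf_sub_strictMono (v := x - θ) (w := r) hα hθ0.le (by linarith)
          (by linarith) (by linarith)
        rw [sub_add_cancel] at h2
        linarith
  rw [coverage, measureReal_congr hae, hg.sampleLaw_Icc θ (by linarith), add_sub_cancel_right]

/-! ### Comparison of increments and strict monotonicity. -/

lemma apply_two_mul_lt (hg : IsSymmUnimodalLogconcaveDensity g) {d : ℝ} (hd : 0 ≤ d)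
    (hgd : 0 < g d) (h2d : densityCdf g (2 * d) < 1) :
    g (2 * d) * (densityCdf g d - 1 / 2) < g d * (1 - densityCdf g d) := by
  have h1 : g (2 * d) * (densityCdf g d - densityCdf g 0)
      ≤ g d * (densityCdf g (2 * d) - densityCdf g d) := by
    have e : densityCdf g (2 * d) - densityCdf g d = ∫ t in (0 : ℝ)..d, g (t + d) := by
      rw [hg.cdf_sub, intervalIntegral.integral_comp_add_right (fun t => g t), zero_add, two_mul]
    rw [e, hg.cdf_sub, ← intervalIntegral.integral_const_mul, ← intervalIntegral.integral_const_mul]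
    refine intervalIntegral.integral_mono_on hd (hg.integrable.const_mul _).intervalIntegrable
      ((hg.integrable.comp_add_right d).const_mul _).intervalIntegrable fun t ht => ?_
    have := hg.mul_le_mul_of_add_eq (x := t) (y := d) (z := t + d) (w := 2 * d) ht.2
      (by linarith) (by ring)
    linarith
  rw [hg.cdf_zero] at h1
  have := mul_pos hgd (sub_pos.2 h2d)
  linarith

lemma apply_le_ratio_mul (hg : IsSymmUnimodalLogconcaveDensity g) {d x y : ℝ} (hd : 0 ≤ d)
    (hgd : 0 < g d) (hx : d ≤ x) (hxy : x + d ≤ y) : g y ≤ g (2 * d) / g d * g x := by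
  have h1 := hg.mul_le_mul_of_add_eq (x := d) (y := x) (z := 2 * d) (w := x + d) hx (by linarith)
    (by ring)
  rw [div_mul_eq_mul_div, le_div_iff₀ hgd]
  have h2 : g y ≤ g (x + d) :=
    hg.antitoneOn (mem_Ici.2 (by linarith)) (mem_Ici.2 (by linarith)) hxy
  have := mul_le_mul_of_nonneg_right h2 hgd.le
  linarith

end IsSymmUnimodalLogconcaveDensity

/-- Comparison of the increments of the two coverage boundaries from first-order bounds. -/
lemma increment_lt_of_bounds {α a b κ X R U V gl gr gu gs : ℝ} (hα : α ∈ Ioo (0 : ℝ) 1)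
    (hb : 0 < b) (hgl : 0 < gl) (hgs : 0 < gs) (hsu : gs ≤ gu)
    (hX : 2 * a / (1 - α) ≤ gl * X) (hR0 : 0 ≤ R) (hR : gr * R ≤ a)
    (hU : gu * U ≤ b / α) (hV : b ≤ gs * V) (hlu : gl ≤ κ * gu) (hlr : gl ≤ κ * gr)
    (hκ : κ * (1 - α) < 2 * α) (h : X - R = U - V) : a < b := by
  by_contra! hba
  obtain ⟨h0, h1⟩ := hα
  have hα1 : 0 < 1 - α := by linarith
  have hgu : 0 < gu := hgs.trans_le hsu
  have hκ0 : 0 ≤ κ := by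
    by_contra! hc
    nlinarith [mul_pos (neg_pos.2 hc) hgu]
  have hV0 : 0 ≤ V := by
    by_contra! hc
    nlinarith [mul_pos (neg_pos.2 hc) hgs]
  have e1 : gu * (U - V) ≤ b / α - b := by
    have := mul_le_mul_of_nonneg_right hsu hV0
    linarith
  have e2 : gl * (X - R) ≤ κ * (b / α - b) := by
    rw [h]
    rcases le_or_gt 0 (U - V) with hd | hd
    · calc gl * (U - V) ≤ κ * gu * (U - V) := mul_le_mul_of_nonneg_right hlu hd
        _ = κ * (gu * (U - V)) := by ring
        _ ≤ _ := mul_le_mul_of_nonneg_left e1 hκ0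
    · have : b ≤ b / α := by rw [le_div_iff₀ h0]; nlinarith
      have := mul_nonneg hκ0 (sub_nonneg.2 this)
      nlinarith [mul_pos hgl (neg_pos.2 hd)]
  have e3 : gl * R ≤ κ * a := by
    have h3 := mul_le_mul_of_nonneg_right hlr hR0
    have h4 := mul_le_mul_of_nonneg_left hR hκ0
    linarith
  have e4 : κ * (b / α - b) < 2 * b := by
    have : κ * (b / α - b) = (κ * (1 - α)) * (b / α) := by field_simp
    rw [this]
    have h3 := mul_lt_mul_of_pos_right hκ (div_pos hb h0)
    have h4 : 2 * α * (b / α) = 2 * b := by field_simp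
    linarith
  -- With `b ≤ a` the bounds clash: `2a < 2a/(1 - α) - κa ≤ gl (X - R) < 2b`.
  have e5 : 2 * a + κ * a < 2 * a / (1 - α) := by
    rw [lt_div_iff₀ hα1]
    have := mul_lt_mul_of_pos_right hκ (hb.trans_le hba)
    linarith
  linarith


theorem theorem1 (g : ℝ → ℝ) (hg : IsSymmUnimodalLogconcaveDensity g)
    (α : ℝ) (hα : α ∈ Set.Ioo (0 : ℝ) 1)
    (l u : ℝ → ℝ)
    (hI : ∀ x : ℝ, 0 < marginalDensity g x → IsHPDCredibleInterval g α x (l x) (u x)) :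
    StrictAntiOn (coverage g l u) (Set.Ioo (dOne g α) (2 * dZero g α)) := by
  obtain ⟨hα0, hα1⟩ := hα
  have hα' : 0 < 1 + α := by linarith
  have hp0 : 1 / 2 < 1 / (1 + α) := one_div_lt_one_div_of_lt hα' (by linarith)
  have hp0' : 1 / (1 + α) < 1 := by rw [div_lt_one hα']; linarith
  have hp1 : 1 / 2 < 1 - α / 2 := by linarith
  have hp1' : 1 - α / 2 < 1 := by linarith
  obtain ⟨d, hd⟩ : ∃ d, d = dZero g α := ⟨_, rfl⟩
  have hd0 : 0 < d := by rw [hd]; exact hg.quantile_pos hp0 hp0'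
  have hGd : densityCdf g d = 1 / (1 + α) := by rw [hd]; exact hg.cdf_quantile hp0 hp0'
  have hle_d : ∀ {z}, 1 / (1 + α) ≤ densityCdf g z → d ≤ z := fun h => by
    rw [hd]; exact hg.quantile_le hp0 h
  have hlt_d : ∀ {z}, z < d → densityCdf g z < 1 / (1 + α) := fun h =>
    hg.cdf_lt_of_lt_quantile hp0 (by rw [hd] at h; exact h)
  have hp01 : 1 / (1 + α) ≤ 1 - α / 2 := by
    rw [div_le_iff₀ hα']
    nlinarith
  have key : ∀ θ ∈ Set.Ioo (dOne g α) (2 * dZero g α), 0 < θ ∧ 1 - α / 2 < densityCdf g θ ∧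
      densityCdf g (θ / 2) < 1 / (1 + α) := by
    intro θ hθ
    have h1 : 0 < dOne g α := hg.quantile_pos hp1 hp1'
    have h2 : densityCdf g (dOne g α) = 1 - α / 2 := hg.cdf_quantile hp1 hp1'
    refine ⟨h1.trans hθ.1, ?_, hlt_d ?_⟩
    · rw [← h2]
      exact hg.cdf_lt h1.le hθ.1 (by rw [h2]; exact hp1')
    · rw [hd]; linarith [hθ.2]
  intro θ₁ hθ₁ θ₂ hθ₂ hlt
  obtain ⟨h1p, h1l, h1u⟩ := key θ₁ hθ₁
  obtain ⟨h2p, h2l, h2u⟩ := key θ₂ hθ₂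
  obtain ⟨a₁, ha1p, ha1θ, ha1⟩ := hg.exists_lower_crossing h1p h1l h1u ⟨hα0, hα1⟩
  obtain ⟨a₂, ha2p, ha2θ, ha2⟩ := hg.exists_lower_crossing h2p h2l h2u ⟨hα0, hα1⟩
  obtain ⟨r₁, hr1p, hr1⟩ := hg.exists_upper_crossing h1p h1l ⟨hα0, hα1⟩
  obtain ⟨r₂, hr2p, hr2⟩ := hg.exists_upper_crossing h2p h2l ⟨hα0, hα1⟩
  rw [hg.coverage_eq ⟨hα0, hα1⟩ hI h1p h1l h1u ha1p ha1θ ha1 hr1p hr1,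
    hg.coverage_eq ⟨hα0, hα1⟩ hI h2p h2l h2u ha2p ha2θ ha2 hr2p hr2]
  have hr1c := hg.cdf_le_of_crossing ⟨hα0, hα1⟩ hr1
  have hr2c := hg.cdf_le_of_crossing ⟨hα0, hα1⟩ hr2
  have hd_le : ∀ {θ r : ℝ}, 0 < θ → 2 * densityCdf g r - 1 = (1 - α) * densityCdf g (r + θ) →
      d ≤ r := by
    intro θ r hθ hr
    apply hle_d
    have := mul_le_mul_of_nonneg_left (hg.cdf_mono (show r ≤ r + θ by linarith))
      (by linarith : 0 ≤ 1 - α)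
    rw [div_le_iff₀ hα']
    linarith
  have hdr1 := hd_le h1p hr1
  have hdr2 := hd_le h2p hr2
  have hdθ1 : d ≤ θ₁ := hle_d (by linarith)
  -- With `d ≤ r₁`, this gives `r₂ + d ≤ r₁ + θ₁`, needed to compare `g(r₁ + θ₁)` with `g(r₂)`
  -- through `κ`.
  have hr2θ1 : r₂ < θ₁ := by
    by_contra! h
    have := hg.cdf_mono h
    linarith
  have ha2d : a₂ ≤ d := by rw [hd]; linarith [hθ₂.2]
  have ha1d : a₁ ≤ d := by rw [hd]; linarith [hθ₁.2]
  have hGa : ∀ {a}, a ≤ d → densityCdf g a < 1 := fun h => by linarith [hg.cdf_mono h]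
  have hneg : densityCdf g (-θ₂) < α * densityCdf g 0 := by
    rw [hg.cdf_neg, hg.cdf_zero]; linarith
  have hs : ∀ a θ, densityCdf g (θ - a) = 1 - densityCdf g (a - θ) := fun a θ => by
    rw [← hg.cdf_neg, neg_sub]
  have ha12 : a₁ < a₂ := by
    by_contra! h
    have h3 : densityCdf g (a₁ - θ₂) < densityCdf g (a₁ - θ₁) := by
      have := hg.cdf_lt (x := θ₁ - a₁) (y := θ₂ - a₁) (by linarith) (by linarith) (by
        rw [hs, ha1]
        have h4 := hg.cdf_mono ha1p.le
        rw [hg.cdf_zero] at h4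
        have := mul_pos hα0 (by linarith : 0 < densityCdf g a₁)
        linarith)
      rw [hs a₁ θ₁, hs a₁ θ₂] at this
      linarith
    rcases h.eq_or_lt with h | h
    · rw [h] at ha2; linarith
    · have := hg.cdf_mul_lt_of_le hα0.le hneg ha2p.le ha2.ge h (by linarith)
      linarith
  have hGa12 := hg.cdf_lt ha1p.le ha12 (hGa ha1d)
  have hb : 0 < α * (densityCdf g a₂ - densityCdf g a₁) := mul_pos hα0 (sub_pos.2 hGa12)
  suffices hmain : densityCdf g r₂ - densityCdf g r₁ < α * (densityCdf g a₂ - densityCdf g a₁) by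
    rw [ha1, ha2]; linarith
  by_contra! hcon
  have hr12 : r₁ < r₂ := by
    by_contra! h
    have := hg.cdf_mono h
    linarith
  have hG12 : densityCdf g (r₁ + θ₁) < densityCdf g (r₂ + θ₂) := by
    have h3 : 0 < (1 - α) * (densityCdf g (r₂ + θ₂) - densityCdf g (r₁ + θ₁)) := by linarith
    exact sub_pos.1 (pos_of_mul_pos_right h3 (by linarith))
  have hX := hg.cdf_sub_le (x := r₁ + θ₁) (y := r₂ + θ₂) (by linarith) (by linarith)
  -- Under the contrary assumption `G` still grows past `r₁ + θ₁`, which supplies the positivity of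
  -- `g` and `G(2d) < 1` even for compactly supported `g`.
  have hgl : 0 < g (r₁ + θ₁) := by
    by_contra! h
    have := mul_nonneg (neg_nonneg.2 h) (by linarith : 0 ≤ r₂ + θ₂ - (r₁ + θ₁))
    linarith
  have hgd : 0 < g d := hgl.trans_le
    (hg.antitoneOn (mem_Ici.2 hd0.le) (mem_Ici.2 (by linarith)) (by linarith))
  have h2d : densityCdf g (2 * d) < 1 := by
    have h3 := hg.cdf_mono (show 2 * d ≤ r₁ + θ₁ by linarith)
    have h4 := hg.cdf_le_one (r₂ + θ₂)
    linarith
  have hs12 : θ₂ - a₂ ≤ θ₁ - a₁ := by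
    by_contra! h
    have h3 := hg.cdf_mono h.le
    rw [hs a₁ θ₁, hs a₂ θ₂, ha1, ha2] at h3
    linarith
  have hV := hg.cdf_sub_le (x := θ₂ - a₂) (y := θ₁ - a₁) (by linarith) hs12
  rw [hs a₁ θ₁, hs a₂ θ₂, ha1, ha2] at hV
  have hgs : 0 < g (θ₂ - a₂) := by
    by_contra! h
    have := mul_nonneg (neg_nonneg.2 h) (by linarith : 0 ≤ θ₁ - a₁ - (θ₂ - a₂))
    linarith
  have hκ := hg.apply_two_mul_lt hd0.le hgd h2d
  rw [hGd] at hκ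
  have hκ' : g (2 * d) / g d * (1 - α) < 2 * α := by
    rw [div_mul_eq_mul_div, div_lt_iff₀ hgd]
    have h3 : (1 / (1 + α) - 1 / 2) = (1 - α) / (2 * (1 + α)) := by field_simp; ring
    have h4 : 1 - 1 / (1 + α) = 2 * α / (2 * (1 + α)) := by field_simp; ring
    rw [h3, h4, ← mul_div_assoc, ← mul_div_assoc, div_lt_div_iff_of_pos_right (by linarith)] at hκ
    linarith
  refine hcon.not_gt (increment_lt_of_bounds (X := r₂ + θ₂ - (r₁ + θ₁)) (R := r₂ - r₁)
    (U := a₂ - a₁) (V := θ₁ - a₁ - (θ₂ - a₂)) (gl := g (r₁ + θ₁)) (gr := g r₂) (gu := g a₂)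
    (gs := g (θ₂ - a₂)) ⟨hα0, hα1⟩ hb hgl hgs ?_ ?_ ?_ ?_ ?_ ?_ ?_ ?_ hκ' (by ring))
  · exact hg.antitoneOn (mem_Ici.2 ha2p.le) (mem_Ici.2 (by linarith)) (by linarith)
  · rw [div_le_iff₀ (by linarith)]
    have := mul_le_mul_of_nonneg_right hX (by linarith : 0 ≤ 1 - α)
    linarith
  · linarith
  · exact hg.le_cdf_sub hr1p.le hr12.le
  · rw [mul_div_cancel_left₀ _ hα0.ne']
    exact hg.le_cdf_sub ha1p.le ha12.le
  · linarith
  · have h3 := hg.apply_le_ratio_mul (x := d) (y := r₁ + θ₁) hd0.le hgd le_rfl (by linarith)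
    have h4 : g d ≤ g a₂ := hg.antitoneOn (mem_Ici.2 ha2p.le) (mem_Ici.2 hd0.le) ha2d
    exact h3.trans (mul_le_mul_of_nonneg_left h4 (div_nonneg (hg.nonneg _) hgd.le))
  · exact hg.apply_le_ratio_mul hd0.le hgd hdr2 (by linarith)
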